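/- All vector spaces are over $\mathbb{C}$. A Leibniz algebra is a vector space $L$ with a bilinear bracket satisfying $[x,[y,z]]=[[x,y],z]-[[x,z],y]$; its nilradical is its maximal nilpotent two-sided ideal. In multiplication tables, omitted products are zero. For $n\ge 6$ let $g^2_{(n,1)}$ be the $n$-dimensional Lie algebra with basis $e_1,\dots,e_n$ and $$[e_1,e_i]=-[e_i,e_1]=e_{i+1}\ (2\le i\le n-2),\qquad [e_i,e_n]=-[e_n,e_i]=e_{i+2}\ (2\le i\le n-3).$$ **Theorem.** Let $n\ge 6$ and let $R$ be a solvable Leibniz algebra whose nilradical $N$ is isomorphic to $g^2_{(n,1)}$ and has a one-dimensional complementary subspace in $R$. Then $R$ admits a basis $\{e_1,\dots,e_n,x\}$ in which the products $[e_i,e_j]$ are those of $g^2_{(n,1)}$ above and the remaining products are given by one of the following tables, for some complex values of the parameters: * $R_1(b_4,\dots,b_{n-1})$: $\ [e_i,x]=-[x,e_i]=e_i+\sum_{t=i+2}^{n-1}b_{t-i+2}e_t$ for $2\le i\le n-1$; * $R_2(a_2)$: $\ [e_1,x]=-[x,e_1]=e_1+a_2e_2$, $\ [e_i,x]=-[x,e_i]=(i-1)e_i$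 for $2\le i\le n-1$, $\ [e_n,x]=-[x,e_n]=-a_2e_3+2e_n$; * $R_3(\gamma_{n-1})$: $\ [e_1,x]=-[x,e_1]=e_1$, $\ [e_i,x]=-[x,e_i]=(i+3-n)e_i$ for $2\le i\le n-1$, $\ [e_n,x]=-[x,e_n]=\gamma_{n-1}e_{n-1}+2e_n$; * $R_4(\delta_{n-1})$: $\ [e_1,x]=-[x,e_1]=e_1$, $\ [e_i,x]=-[x,e_i]=(i+1-n)e_i$ for $2\le i\le n-1$, $\ [e_n,x]=-[x,e_n]=2e_n$, $\ [x,x]=\delta_{n-1}e_{n-1}$; * $R_5(b_2)$ with $b_2\notin\{1,\,5-n,\,3-n\}$: $\ [e_1,x]=-[x,e_1]=e_1$, $\ [e_i,x]=-[x,e_i]=(i-2+b_2)e_i$ for $2\le i\le n-1$, $\ [e_n,x]=-[x,e_n]=2e_n$. -/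

import Mathlib

/-- A (right) Leibniz algebra over `ℂ`: a complex vector space with a bilinear bracket satisfying
`[x, [y, z]] = [[x, y], z] - [[x, z], y]`. -/
class LeibnizAlgebra (L : Type*) [AddCommGroup L] [Module ℂ L] where
  /-- The bilinear bracket `[x, y] = bracket x y`. -/
  bracket : L →ₗ[ℂ] L →ₗ[ℂ] L
  leibniz : ∀ x y z : L,
    bracket x (bracket y z) = bracket (bracket x y) z - bracket (bracket x z) y

namespace LeibnizAlgebra

/-- Two-sided ideals. -/
def IsIdeal {L : Type*} [AddCommGroup L] [Module ℂ L] [LeibnizAlgebra L]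
    (I : Submodule ℂ L) : Prop :=
  ∀ a ∈ I, ∀ y : L, bracket a y ∈ I ∧ bracket y a ∈ I

/-- `[I, J]`, the span of all `[a, b]` with `a ∈ I`, `b ∈ J`. -/
def bracketSpan {L : Type*} [AddCommGroup L] [Module ℂ L] [LeibnizAlgebra L]
    (I J : Submodule ℂ L) : Submodule ℂ L :=
  Submodule.map₂ bracket I J

/-- The lower central series of `I`, regarded as an algebra in its own right
(index shifted by one: `lowerCentral I 0 = I`). -/
def lowerCentral {L : Type*} [AddCommGroup L] [Module ℂ L] [LeibnizAlgebra L]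
    (I : Submodule ℂ L) : ℕ → Submodule ℂ L
  | 0 => I
  | k + 1 => bracketSpan (lowerCentral I k) I

/-- The derived series of `I` (index shifted by one: `derived I 0 = I`). -/
def derived {L : Type*} [AddCommGroup L] [Module ℂ L] [LeibnizAlgebra L]
    (I : Submodule ℂ L) : ℕ → Submodule ℂ L
  | 0 => I
  | k + 1 => bracketSpan (derived I k) (derived I k)

/-- `I` is nilpotent as an algebra. -/
def Nilpotent {L : Type*} [AddCommGroup L] [Module ℂ L] [LeibnizAlgebra L]
    (I : Submodule ℂ L) : Prop :=
  ∃ k, lowerCentral I k = ⊥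

/-- The Leibniz algebra `L` is solvable. -/
def Solvable (L : Type*) [AddCommGroup L] [Module ℂ L] [LeibnizAlgebra L] : Prop :=
  ∃ k, derived (⊤ : Submodule ℂ L) k = ⊥

/-- `N` is the nilradical: the maximal nilpotent (two-sided) ideal. -/
def IsNilradical {L : Type*} [AddCommGroup L] [Module ℂ L] [LeibnizAlgebra L]
    (N : Submodule ℂ L) : Prop :=
  Maximal (fun I : Submodule ℂ L => IsIdeal I ∧ Nilpotent I) N

/-- Turns a family `v` indexed by `Fin n` into `e_1, …, e_n` with `e_i = v (i - 1)`
(and `e_i = 0` for all other `i`). -/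
def oneIndexed {L : Type*} [AddCommGroup L] {n : ℕ} (v : Fin n → L) (i : ℕ) : L :=
  if h : 1 ≤ i ∧ i ≤ n then v ⟨i - 1, by omega⟩ else 0

/-- The products of `e_1, …, e_n` are those of the Lie algebra `g²_{(n,1)}`:
`[e_1, e_i] = -[e_i, e_1] = e_{i+1}` for `2 ≤ i ≤ n - 2`,
`[e_i, e_n] = -[e_n, e_i] = e_{i+2}` for `2 ≤ i ≤ n - 3`, all others being zero. -/
def G2Table {L : Type*} [AddCommGroup L] [Module ℂ L] [LeibnizAlgebra L]
    (n : ℕ) (e : ℕ → L) : Prop :=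
  ∀ i ∈ Finset.Icc 1 n, ∀ j ∈ Finset.Icc 1 n,
    bracket (e i) (e j) =
      if i = 1 ∧ 2 ≤ j ∧ j + 2 ≤ n then e (j + 1)
      else if j = 1 ∧ 2 ≤ i ∧ i + 2 ≤ n then -e (i + 1)
      else if j = n ∧ 2 ≤ i ∧ i + 3 ≤ n then e (i + 2)
      else if i = n ∧ 2 ≤ j ∧ j + 3 ≤ n then -e (j + 2)
      else 0

/-- `N`, with the bracket of the ambient algebra, is (isomorphic to) `g²_{(n,1)}`. -/
def IsG2 {L : Type*} [AddCommGroup L] [Module ℂ L] [LeibnizAlgebra L]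
    (n : ℕ) (N : Submodule ℂ L) : Prop :=
  ∃ v : Module.Basis (Fin n) ℂ N, G2Table n (oneIndexed fun k => (v k : L))

/-- The products involving `x` are `[e_i, x] = -[x, e_i] = d i` and `[x, x] = q`; the products of
the `e_i` are those of `g²_{(n,1)}`. -/
def ExtensionTable {L : Type*} [AddCommGroup L] [Module ℂ L] [LeibnizAlgebra L]
    (n : ℕ) (e : ℕ → L) (x : L) (d : ℕ → L) (q : L) : Prop :=
  G2Table n e ∧
  (∀ i ∈ Finset.Icc 1 n, bracket (e i) x = d i ∧ bracket x (e i) = -d i) ∧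
  bracket x x = q

/-- The table `R_1(g²_{(n,1)}, 1)(b_4, …, b_{n-1})`. -/
def R1Table {L : Type*} [AddCommGroup L] [Module ℂ L] [LeibnizAlgebra L]
    (n : ℕ) (b : ℕ → ℂ) (e : ℕ → L) (x : L) : Prop :=
  ExtensionTable n e x
    (fun i => if 2 ≤ i ∧ i + 1 ≤ n then
        e i + ∑ t ∈ Finset.Icc (i + 2) (n - 1), b (t - i + 2) • e t
      else 0) 0

/-- The table `R_2(g²_{(n,1)}, 1)(a_2)`. -/
def R2Table {L : Type*} [AddCommGroup L] [Module ℂ L] [LeibnizAlgebra L]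
    (n : ℕ) (a₂ : ℂ) (e : ℕ → L) (x : L) : Prop :=
  ExtensionTable n e x
    (fun i => if i = 1 then e 1 + a₂ • e 2
      else if i = n then -(a₂ • e 3) + (2 : ℂ) • e n
      else ((i : ℂ) - 1) • e i) 0

/-- The table `R_3(g²_{(n,1)}, 1)(γ_{n-1})`. -/
def R3Table {L : Type*} [AddCommGroup L] [Module ℂ L] [LeibnizAlgebra L]
    (n : ℕ) (γ : ℂ) (e : ℕ → L) (x : L) : Prop :=
  ExtensionTable n e x
    (fun i => if i = 1 then e 1
      else if i = n then γ • e (n - 1) + (2 : ℂ) • e n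
      else ((i : ℂ) + 3 - n) • e i) 0

/-- The table `R_4(g²_{(n,1)}, 1)(δ_{n-1})`. -/
def R4Table {L : Type*} [AddCommGroup L] [Module ℂ L] [LeibnizAlgebra L]
    (n : ℕ) (δ : ℂ) (e : ℕ → L) (x : L) : Prop :=
  ExtensionTable n e x
    (fun i => if i = 1 then e 1
      else if i = n then (2 : ℂ) • e n
      else ((i : ℂ) + 1 - n) • e i) (δ • e (n - 1))

/-- The table of `R_5(g²_{(n,1)}, 1)(b_2)`. -/
def R5Table {L : Type*} [AddCommGroup L] [Module ℂ L] [LeibnizAlgebra L]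
    (n : ℕ) (b₂ : ℂ) (e : ℕ → L) (x : L) : Prop :=
  ExtensionTable n e x
    (fun i => if i = 1 then e 1
      else if i = n then (2 : ℂ) • e n
      else ((i : ℂ) - 2 + b₂) • e i) 0

end LeibnizAlgebra

/-! Write n = l + 3, f_k = e_{k+2}, and let x span the complement. By the Leibniz identity, right
multiplication by x is a derivation of N. On ⟨f_0, …, f_l⟩ the element eₙ acts through the square of
the shift [e₁, ·], so the relations leave little freedom: the diagonal is a on e₁, b + ka on f_k and
2a on eₙ, with off-diagonal data v, z, γ (`exists_act`).

Left multiplication is nearly determined: [x, y] + [y, x] is annihilated by every left factor, hence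
lies on the line of f_l. This error vanishes once (a, b) ≠ (0, 0) (`left_eq_neg_right`), and (0, 0)
is impossible because R would be nilpotent, against the maximality of N (`not_nilpotent`). Also [x,
x] = δ f_l with δ(b + la) = 0.

It remains to normalise, rescaling x, translating it by N and changing the basis of N. For a = 0,
scale to b = 1; only the part of z from f_2 on survives, which gives R_1. For a = 1, all of z can be
removed; a₂ survives only for b = 1, γ only for b = 2 - l, and δ only for b = -l. These distinct
resonances give R_2, R_3, R_4; every other b gives R_5. -/

namespace LeibnizAlgebra

/-! ### Flags and triangular maps -/

section

variable {R : Type*} [AddCommGroup R] [Module ℂ R]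

/-- The span of `f k, f (k + 1), …`. -/
def tail (f : ℕ → R) (k : ℕ) : Submodule ℂ R :=
  Submodule.span ℂ (f '' Set.Ici k)

section Tail

variable {f : ℕ → R} {k : ℕ}

theorem mem_tail {j : ℕ} (h : k ≤ j) : f j ∈ tail f k :=
  Submodule.subset_span ⟨j, h, rfl⟩

theorem tail_le {P : Submodule ℂ R} (h : ∀ j, k ≤ j → f j ∈ P) : tail f k ≤ P := by
  refine Submodule.span_le.2 ?_
  rintro _ ⟨j, hj, rfl⟩
  exact h j hj

theorem tail_anti {j : ℕ} (h : j ≤ k) : tail f k ≤ tail f j :=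
  tail_le fun _ hi => mem_tail (h.trans hi)

theorem map_mem_of_mem_tail {P : Submodule ℂ R} (g : R →ₗ[ℂ] R)
    (h : ∀ j, k ≤ j → g (f j) ∈ P) {y : R} (hy : y ∈ tail f k) : g y ∈ P :=
  tail_le (P := P.comap g) h hy

theorem eq_of_mem_tail (g g' : R →ₗ[ℂ] R) (h : ∀ j, k ≤ j → g (f j) = g' (f j))
    {y : R} (hy : y ∈ tail f k) : g y = g' y :=
  tail_le (P := LinearMap.eqLocus g g') h hy

theorem exists_of_mem_tail {y : R} (hy : y ∈ tail f k) :
    ∃ c : ℂ, ∃ y' ∈ tail f (k + 1), y = c • f k + y' := by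
  have : f '' Set.Ici k = insert (f k) (f '' Set.Ici (k + 1)) := by
    rw [← Set.image_insert_eq]
    congr 1
    ext j
    simp only [Set.mem_Ici, Set.mem_insert_iff]
    omega
  rw [tail, this, Submodule.mem_span_insert] at hy
  exact hy

theorem exists_sum_of_mem_tail {l : ℕ} (hf : ∀ j, l < j → f j = 0) {y : R} (hy : y ∈ tail f k) :
    ∃ c : ℕ → ℂ, y = ∑ t ∈ Finset.Icc k l, c t • f t := by
  refine Submodule.span_induction (p := fun y _ => ∃ c : ℕ → ℂ,
    y = ∑ t ∈ Finset.Icc k l, c t • f t) ?_ ⟨0, by simp⟩ ?_ ?_ hy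
  · rintro _ ⟨j, hj, rfl⟩
    by_cases h : j ≤ l
    · refine ⟨Pi.single j 1, ?_⟩
      rw [Finset.sum_eq_single j]
      · simp
      · intro b _ hb
        simp [hb]
      · intro h'
        exact absurd (Finset.mem_Icc.2 ⟨hj, h⟩) h'
    · exact ⟨0, by simp [hf j (by omega)]⟩
  · rintro _ _ _ _ ⟨c, rfl⟩ ⟨c', rfl⟩
    exact ⟨c + c', by simp [add_smul, Finset.sum_add_distrib]⟩
  · rintro r _ _ ⟨c, rfl⟩
    exact ⟨r • c, by simp [Finset.smul_sum, mul_smul]⟩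

/-- An endomorphism that is triangular with nonzero diagonal on a flag is onto. -/
theorem exists_preimage_of_triangular {l : ℕ} (hf : ∀ j, l < j → f j = 0) (E : R →ₗ[ℂ] R)
    (μ : ℕ → ℂ) (hμ : ∀ j, k ≤ j → μ j ≠ 0)
    (hE : ∀ j, k ≤ j → E (f j) - μ j • f j ∈ tail f (j + 1)) :
    ∀ v ∈ tail f k, ∃ u ∈ tail f k, E u = v := by
  suffices H : ∀ d j, k ≤ j → l + 1 ≤ j + d → ∀ v ∈ tail f j, ∃ u ∈ tail f j, E u = v from
    H (l + 1) k le_rfl (by omega)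
  intro d
  induction d with
  | zero =>
    intro j _ hj v hv
    have h0 : tail f j ≤ ⊥ := tail_le fun i hi => by simp [hf i (by omega)]
    exact ⟨0, zero_mem _, by simp [(Submodule.mem_bot ℂ).1 (h0 hv)]⟩
  | succ d ih =>
    intro j hkj hj v hv
    obtain ⟨c, v', hv', rfl⟩ := exists_of_mem_tail hv
    obtain ⟨u, hu, hEu⟩ := ih (j + 1) (by omega) (by omega)
      (v' - (c / μ j) • (E (f j) - μ j • f j))
      (sub_mem hv' (Submodule.smul_mem _ _ (hE j hkj)))
    refine ⟨(c / μ j) • f j + u, add_mem (Submodule.smul_mem _ _ (mem_tail le_rfl))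
      (tail_anti (by omega) hu), ?_⟩
    rw [map_add, map_smul, hEu, smul_sub, smul_smul, div_mul_cancel₀ _ (hμ j hkj)]
    abel

end Tail

/-! ### Leibniz identities and the structure of `g²` -/

variable [LeibnizAlgebra R]

/-- The Leibniz identity in the form used throughout: right multiplications are derivations. -/
theorem bracket_bracket_right (y z x : R) :
    bracket (bracket y z) x = bracket (bracket y x) z + bracket y (bracket z x) := by
  rw [leibniz y z x]
  abel

/-- The right-hand side of the Leibniz identity is antisymmetric in its last two arguments. -/
theorem bracket_symm_right_eq_zero (p y z : R) :
    bracket p (bracket y z + bracket z y) = 0 := by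
  rw [map_add, leibniz p y z, leibniz p z y]
  abel

/-- `e₁, f 0, …, f l, eₙ` is a basis of `N` (with `f k = 0` for `k > l`) in which the products are
those of `g²_{(l + 3, 1)}`; linear independence follows from `f l ≠ 0`. -/
structure Frame (l : ℕ) (N : Submodule ℂ R) (e₁ eₙ : R) (f : ℕ → R) : Prop where
  one_mem : e₁ ∈ N
  n_mem : eₙ ∈ N
  f_mem : ∀ k, f k ∈ N
  exists_coord : ∀ y ∈ N, ∃ p q : ℂ, ∃ v ∈ tail f 0, y = p • e₁ + q • eₙ + v
  f_last : f l ≠ 0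
  f_zero : ∀ k, l < k → f k = 0
  one_one : bracket e₁ e₁ = 0
  one_n : bracket e₁ eₙ = 0
  n_one : bracket eₙ e₁ = 0
  n_n : bracket eₙ eₙ = 0
  one_f : ∀ k, bracket e₁ (f k) = f (k + 1)
  f_one : ∀ k, bracket (f k) e₁ = -f (k + 1)
  f_n : ∀ k, bracket (f k) eₙ = f (k + 2)
  n_f : ∀ k, bracket eₙ (f k) = -f (k + 2)
  f_f : ∀ j k, bracket (f j) (f k) = 0

namespace Frame

variable {l : ℕ} {N : Submodule ℂ R} {e₁ eₙ : R} {f : ℕ → R}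

section Basic

variable (F : Frame l N e₁ eₙ f)
include F

theorem tail_eq_bot {k : ℕ} (hk : l < k) : tail f k = ⊥ :=
  le_bot_iff.1 (tail_le fun i hi => by simp [F.f_zero i (by omega)])

theorem tail_le_N (k : ℕ) : tail f k ≤ N := tail_le fun j _ => F.f_mem j

theorem one_mem_tail {k : ℕ} {y : R} (hy : y ∈ tail f k) : bracket e₁ y ∈ tail f (k + 1) :=
  map_mem_of_mem_tail _ (fun j hj => by rw [F.one_f]; exact mem_tail (by omega)) hy

theorem tail_one {v : R} (hv : v ∈ tail f 0) : bracket v e₁ = -bracket e₁ v :=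
  eq_of_mem_tail (bracket.flip e₁) (-bracket e₁) (fun j _ => by simp [F.f_one, F.one_f]) hv

theorem tail_n {v : R} (hv : v ∈ tail f 0) : bracket v eₙ = bracket e₁ (bracket e₁ v) :=
  eq_of_mem_tail (bracket.flip eₙ) (bracket e₁ ∘ₗ bracket e₁)
    (fun j _ => by simp [F.f_n, F.one_f]) hv

theorem n_tail {v : R} (hv : v ∈ tail f 0) : bracket eₙ v = -bracket e₁ (bracket e₁ v) :=
  eq_of_mem_tail (bracket eₙ) (-(bracket e₁ ∘ₗ bracket e₁))
    (fun j _ => by simp [F.n_f, F.one_f]) hv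

theorem tail_tail {v w : R} (hv : v ∈ tail f 0) (hw : w ∈ tail f 0) : bracket v w = 0 := by
  refine eq_of_mem_tail (bracket v) 0 (fun j _ => ?_) hw
  exact eq_of_mem_tail (bracket.flip (f j)) 0 (fun i _ => by simp [F.f_f]) hv

/-- Each application of [e₁, ·] shifts the relation one step down the flag, until only c f_l is
left. -/
theorem coeff_eq_zero {k : ℕ} (hk : k ≤ l) {c : ℂ} {y : R} (hy : y ∈ tail f (k + 1))
    (h : c • f k + y = 0) : c = 0 := by
  obtain ⟨d, hd⟩ := Nat.exists_eq_add_of_le hk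
  induction d generalizing k y with
  | zero =>
    obtain rfl : k = l := by omega
    rw [F.tail_eq_bot (by omega), Submodule.mem_bot] at hy
    rw [hy, add_zero, smul_eq_zero] at h
    exact h.resolve_right F.f_last
  | succ d ih =>
    refine ih (k := k + 1) (by omega) (F.one_mem_tail hy) ?_ (by omega)
    have := congrArg (bracket e₁) h
    simpa [F.one_f] using this

theorem one_pow_f (j k : ℕ) : (bracket e₁ ^ j) (f k) = f (k + j) := by
  induction j with
  | zero => simp
  | succ j ih => rw [pow_succ', Module.End.mul_apply, ih, F.one_f, add_assoc]

theorem one_pow_mem_tail (j : ℕ) {k : ℕ} {y : R} (hy : y ∈ tail f k) :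
    (bracket e₁ ^ j) y ∈ tail f (k + j) :=
  map_mem_of_mem_tail _ (fun i hi => by rw [F.one_pow_f]; exact mem_tail (by omega)) hy

theorem mem_tail_last_of_one_eq_zero {v : R} (hv : v ∈ tail f 0) (h : bracket e₁ v = 0) :
    ∃ c : ℂ, v = c • f l := by
  suffices H : ∀ k, k ≤ l → v ∈ tail f k by
    obtain ⟨c, y, hy, rfl⟩ := exists_of_mem_tail (H l le_rfl)
    rw [F.tail_eq_bot (by omega), Submodule.mem_bot] at hy
    exact ⟨c, by rw [hy, add_zero]⟩
  intro k
  induction k with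
  | zero => exact fun _ => hv
  | succ k ih =>
    intro hk
    obtain ⟨c, y, hy, rfl⟩ := exists_of_mem_tail (ih (by omega))
    rw [map_add, map_smul, F.one_f] at h
    rw [F.coeff_eq_zero hk (F.one_mem_tail hy) h, zero_smul, zero_add]
    exact hy

theorem coeff_one_n_eq_zero {p q : ℂ} {k : ℕ} (hk : k + 2 ≤ l)
    (h : -(p • f (k + 1)) + q • f (k + 2) = 0) : p = 0 ∧ q = 0 := by
  have hp : -p = 0 := F.coeff_eq_zero (k := k + 1) (by omega) (y := q • f (k + 2))
    (Submodule.smul_mem _ _ (mem_tail le_rfl)) (by rw [neg_smul]; exact h)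
  have hp : p = 0 := neg_eq_zero.1 hp
  refine ⟨hp, F.coeff_eq_zero (k := k + 2) hk (y := 0) (zero_mem _) ?_⟩
  simpa [hp] using h

/-- Left multiplication by f_0 kills v and turns p and q into the coefficients of f_1 and f_2, up to
sign. -/
theorem linearIndependent_aux (hl : 3 ≤ l) {p q : ℂ} {v : R} (hv : v ∈ tail f 0)
    (h : p • e₁ + q • eₙ + v = 0) : p = 0 ∧ q = 0 ∧ v = 0 := by
  have h1 := congrArg (bracket (f 0)) h
  simp only [map_add, map_smul, F.f_one, F.f_n, map_zero,
    F.tail_tail (mem_tail le_rfl) hv, add_zero, smul_neg] at h1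
  obtain ⟨rfl, rfl⟩ := F.coeff_one_n_eq_zero (k := 0) (by omega) h1
  exact ⟨rfl, rfl, by simpa using h⟩

theorem exists_of_right_annihilator (hl : 3 ≤ l) {r : R} (hr : r ∈ N)
    (h : ∀ p, bracket p r = 0) : ∃ c : ℂ, r = c • f l := by
  obtain ⟨p, q, v, hv, rfl⟩ := F.exists_coord r hr
  have h1 := h (f 0)
  simp only [map_add, map_smul, F.f_one, F.f_n,
    F.tail_tail (mem_tail le_rfl) hv, add_zero, smul_neg] at h1
  obtain ⟨rfl, rfl⟩ := F.coeff_one_n_eq_zero (k := 0) (by omega) h1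
  have h2 := h e₁
  simp only [zero_smul, zero_add] at h2 ⊢
  exact F.mem_tail_last_of_one_eq_zero hv h2

theorem last_bracket {y : R} (hy : y ∈ N) : bracket (f l) y = 0 := by
  obtain ⟨p, q, v, hv, rfl⟩ := F.exists_coord y hy
  simp [F.f_one, F.f_n, F.tail_tail (mem_tail (Nat.zero_le l)) hv, F.f_zero]

end Basic

/-! ### Derivations of `g²` -/

/-- Right multiplication by `x` on the frame. -/
structure Act (F : Frame l N e₁ eₙ f) (x : R) (a b γ : ℂ) (v z : R) : Prop where
  v_mem : v ∈ tail f 0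
  z_mem : z ∈ tail f 1
  one_x : bracket e₁ x = a • e₁ + v
  n_x : bracket eₙ x = (2 * a) • eₙ - bracket e₁ v + γ • f l
  zero_x : bracket (f 0) x = b • f 0 + z

theorem exists_act (hl : 3 ≤ l) (F : Frame l N e₁ eₙ f) {x : R} (hx : ∀ y ∈ N, bracket y x ∈ N) :
    ∃ a b γ v z, F.Act x a b γ v z := by
  obtain ⟨a, c, v, hv, h1⟩ := F.exists_coord _ (hx _ F.one_mem)
  obtain ⟨α, β, w, hw, h2⟩ := F.exists_coord _ (hx _ F.n_mem)
  obtain ⟨p, q, z, hz, h3⟩ := F.exists_coord _ (hx _ (F.f_mem 0))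
  have f0 : ∀ k, f k ∈ tail f 0 := fun k => mem_tail (Nat.zero_le k)
  have g1 : bracket (f 1) x = a • f 1 - c • f 2 + bracket e₁ z := by
    have := bracket_bracket_right e₁ (f 0) x
    rw [F.one_f, h1, h3] at this
    simp only [zero_add, map_add, map_smul, LinearMap.add_apply, LinearMap.smul_apply,
      F.one_f, F.n_f, F.one_one, F.one_n, F.tail_tail hv (f0 0)] at this
    rw [this]
    module
  -- Since f_2 is both [e₁, f_1] and [f_0, eₙ], the derivation has two values on it. Comparing
  -- coefficients of f_1, f_2, f_3 gives α = 0, β = 2a, c = 0; here l ≥ 3 is needed.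
  have g2 : bracket (f 2) x = (2 * a) • f 2 - (2 * c) • f 3 + bracket e₁ (bracket e₁ z) := by
    have := bracket_bracket_right e₁ (f 1) x
    rw [F.one_f, h1, g1] at this
    simp only [map_add, map_sub, map_smul, LinearMap.add_apply, LinearMap.smul_apply,
      F.one_f, F.n_f, F.tail_tail hv (f0 1), Nat.reduceAdd] at this
    rw [this]
    module
  have g2' : bracket (f 2) x = -(α • f 1) + β • f 2 + bracket e₁ (bracket e₁ z) := by
    have := bracket_bracket_right (f 0) eₙ x
    rw [F.f_n, h3, h2] at this
    simp only [map_add, map_smul, LinearMap.add_apply, LinearMap.smul_apply,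
      F.f_one, F.f_n, F.one_n, F.n_n, F.tail_tail (f0 0) hw, F.tail_n hz, Nat.reduceAdd] at this
    rw [this]
    module
  have g3 : α • f 1 + ((2 * a - β) • f 2 + (-(2 * c)) • f 3) = 0 := by
    rw [← sub_eq_zero.2 (g2.symm.trans g2')]
    module
  have hα : α = 0 := F.coeff_eq_zero (k := 1) (by omega)
    (add_mem (Submodule.smul_mem _ _ (mem_tail (by omega)))
      (Submodule.smul_mem _ _ (mem_tail (by omega)))) g3
  rw [hα, zero_smul, zero_add] at g3
  have hβ : 2 * a - β = 0 := F.coeff_eq_zero (k := 2) (by omega)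
    (Submodule.smul_mem _ _ (mem_tail (by omega))) g3
  rw [hβ, zero_smul, zero_add] at g3
  have hc : -(2 * c) = 0 := F.coeff_eq_zero (k := 3) (by omega) (y := 0) (zero_mem _)
    (by rw [add_zero]; exact g3)
  have hc : c = 0 := by simpa using hc
  have hβ : β = 2 * a := (sub_eq_zero.1 hβ).symm
  subst hα hβ hc
  -- The relation [f_0, f_1] = 0 excludes e₁ and eₙ from the image of f_0.
  have g4 : -(p • f 2) + q • f 3 = 0 := by
    have := bracket_bracket_right (f 0) (f 1) x
    rw [F.f_f, h3, g1] at this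
    simp only [map_add, map_sub, map_smul, LinearMap.add_apply, LinearMap.smul_apply,
      LinearMap.zero_apply, map_zero, F.one_f, F.n_f, F.f_f, F.tail_tail hz (f0 1),
      F.tail_tail (f0 0) (tail_anti (Nat.zero_le _) (F.one_mem_tail hz)), Nat.reduceAdd] at this
    rw [← sub_eq_zero.2 this]
    module
  obtain ⟨hp, hq⟩ := F.coeff_one_n_eq_zero (k := 1) (by omega) g4
  subst hp hq
  -- The relation [e₁, eₙ] = 0 determines w as -[e₁, v] up to the kernel of [e₁, ·], which is the
  -- line of f_l.
  have g5 : bracket e₁ (bracket e₁ v + w) = 0 := by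
    have := bracket_bracket_right e₁ eₙ x
    rw [F.one_n, h1, h2] at this
    simp only [map_add, map_smul, LinearMap.add_apply, LinearMap.smul_apply,
      LinearMap.zero_apply, map_zero, F.one_one, F.one_n, F.tail_n hv] at this
    rw [map_add]
    simpa using this.symm
  obtain ⟨γ, hγ⟩ := F.mem_tail_last_of_one_eq_zero
    (add_mem (tail_anti (Nat.zero_le _) (F.one_mem_tail hv)) hw) g5
  obtain ⟨b, z', hz', rfl⟩ := exists_of_mem_tail hz
  refine ⟨a, b, γ, v, z', hv, hz', ?_, ?_, ?_⟩
  · rw [h1]; module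
  · rw [h2, ← hγ]; module
  · rw [h3]; module

namespace Act

variable {F : Frame l N e₁ eₙ f} {x : R} {a b γ : ℂ} {v z : R} (A : F.Act x a b γ v z)
include A

theorem one_tail_x {y : R} (hy : y ∈ tail f 0) :
    bracket (bracket e₁ y) x = a • bracket e₁ y + bracket e₁ (bracket y x) := by
  rw [bracket_bracket_right, A.one_x]
  simp [F.tail_tail A.v_mem hy]

theorem f_x (k : ℕ) :
    bracket (f k) x = (b + k * a) • f k + (bracket e₁ ^ k) z := by
  induction k with
  | zero => simp [A.zero_x]
  | succ k ih =>
    rw [← F.one_f, A.one_tail_x (mem_tail (Nat.zero_le k)), ih, map_add, map_smul, F.one_f,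
      pow_succ', Module.End.mul_apply]
    push_cast
    module

theorem f_x_sub_mem (k : ℕ) : bracket (f k) x - (b + k * a) • f k ∈ tail f (k + 1) := by
  rw [A.f_x, add_sub_cancel_left, add_comm k]
  exact F.one_pow_mem_tail k A.z_mem

theorem tail_x_mem {k : ℕ} {y : R} (hy : y ∈ tail f k) : bracket y x ∈ tail f k := by
  refine map_mem_of_mem_tail (bracket.flip x) (fun j hj => ?_) hy
  rw [LinearMap.flip_apply, A.f_x]
  refine add_mem (Submodule.smul_mem _ _ (mem_tail hj)) (tail_anti ?_ (F.one_pow_mem_tail j A.z_mem))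
  omega

theorem last_x : bracket (f l) x = (b + l * a) • f l := by
  have h := F.one_pow_mem_tail l A.z_mem
  rw [F.tail_eq_bot (by omega), Submodule.mem_bot] at h
  rw [A.f_x, h, add_zero]

end Act

end Frame

end

/-! ### The complement and left multiplication by `x` -/

section

variable {R : Type*} [AddCommGroup R] [Module ℂ R]

/-- `x` spans a complement of `N`. -/
def SpansCompl (N : Submodule ℂ R) (x : R) : Prop :=
  x ∉ N ∧ ∀ r, ∃ c : ℂ, ∃ y ∈ N, r = c • x + y

namespace SpansCompl

variable {N : Submodule ℂ R} {x : R}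

theorem smul_add_mem (hx : SpansCompl N x) {s : ℂ} (hs : s ≠ 0) {y : R} (hy : y ∈ N) :
    SpansCompl N (s • x + y) := by
  refine ⟨fun h => hx.1 ?_, fun r => ?_⟩
  · have := (N.add_mem_iff_left hy).1 h
    exact (N.smul_mem_iff hs).1 this
  · obtain ⟨c, w, hw, rfl⟩ := hx.2 r
    refine ⟨c / s, w - (c / s) • y, sub_mem hw (N.smul_mem _ hy), ?_⟩
    rw [smul_add, smul_smul, div_mul_cancel₀ _ hs]
    abel

variable [LeibnizAlgebra R]

/-- If [x, x] ≡ c x modulo N, then the identity [x, [x, x]] = 0 gives c² x ∈ N, so c = 0. -/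
theorem bracket_self_mem (hx : SpansCompl N x) (hI : IsIdeal N) : bracket x x ∈ N := by
  obtain ⟨c, y, hy, h⟩ := hx.2 (bracket x x)
  have h0 : bracket x (bracket x x) = 0 := by rw [leibniz, sub_self]
  rw [h, map_add, map_smul, h] at h0
  have h1 : c • c • x + (c • y + bracket x y) = 0 := by
    rw [← h0]
    module
  have h2 : c • c • x ∈ N :=
    (N.add_mem_iff_left (add_mem (N.smul_mem _ hy) (hI y hy x).2)).1 (h1 ▸ N.zero_mem)
  by_cases hc : c = 0
  · rw [h, hc, zero_smul, zero_add]
    exact hy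
  · exact absurd ((N.smul_mem_iff hc).1 ((N.smul_mem_iff hc).1 h2)) hx.1

theorem bracket_mem (hx : SpansCompl N x) (hI : IsIdeal N) (r s : R) : bracket r s ∈ N := by
  obtain ⟨c, y, hy, rfl⟩ := hx.2 r
  obtain ⟨d, w, hw, rfl⟩ := hx.2 s
  simp only [map_add, map_smul, LinearMap.add_apply, LinearMap.smul_apply]
  refine add_mem (N.smul_mem _ (add_mem (N.smul_mem _ (hx.bracket_self_mem hI)) ?_))
    (add_mem (N.smul_mem _ ?_) ?_)
  · exact (hI y hy x).1
  · exact (hI w hw x).2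
  · exact (hI w hw y).2

end SpansCompl

variable [LeibnizAlgebra R]

namespace Frame

variable {l : ℕ} {N : Submodule ℂ R} {e₁ eₙ : R} {f : ℕ → R}

theorem exists_right_add_left (hl : 3 ≤ l) (F : Frame l N e₁ eₙ f) (hI : IsIdeal N) (x : R)
    {y : R} (hy : y ∈ N) : ∃ c : ℂ, bracket x y + bracket y x = c • f l :=
  F.exists_of_right_annihilator hl (add_mem (hI y hy x).2 (hI y hy x).1)
    fun p => bracket_symm_right_eq_zero p x y

namespace Act

variable {F : Frame l N e₁ eₙ f} {x : R} {a b γ : ℂ} {v z : R}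

/-- In the expansion of [x, [e₁, y]] the symmetric errors at e₁ and y enter only as multiples of
[f_l, y] and [f_l, e₁], which vanish. -/
theorem left_one_tail (hl : 3 ≤ l) (A : F.Act x a b γ v z) (hI : IsIdeal N) {y : R}
    (hy : y ∈ tail f 0) : bracket x (bracket e₁ y) + bracket (bracket e₁ y) x = 0 := by
  obtain ⟨c, hc⟩ := F.exists_right_add_left hl hI x F.one_mem
  obtain ⟨d, hd⟩ := F.exists_right_add_left hl hI x (F.tail_le_N _ hy)
  rw [leibniz, eq_sub_of_add_eq hc, eq_sub_of_add_eq hd, bracket_bracket_right e₁ y x]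
  simp only [map_sub, map_smul, LinearMap.sub_apply, LinearMap.smul_apply,
    F.last_bracket (F.tail_le_N _ hy), F.last_bracket F.one_mem, F.tail_one (A.tail_x_mem hy)]
  module

theorem left_tail_one (hl : 3 ≤ l) (A : F.Act x a b γ v z) (hI : IsIdeal N) {y : R}
    (hy : y ∈ tail f 1) : bracket x y + bracket y x = 0 := by
  refine eq_of_mem_tail (bracket x + bracket.flip x) 0 (fun j hj => ?_) hy
  obtain ⟨k, rfl⟩ := Nat.exists_eq_add_of_le' hj
  rw [← F.one_f]
  exact A.left_one_tail hl hI (mem_tail (Nat.zero_le k))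

theorem smul_last_eq_zero (hl : 3 ≤ l) (A : F.Act x a b γ v z) (hI : IsIdeal N) {c : ℂ}
    (h : bracket x (c • f l) = 0) : c * (b + l * a) = 0 := by
  have h1 := A.left_tail_one hl hI (mem_tail (f := f) (k := 1) (j := l) (by omega))
  rw [A.last_x] at h1
  rw [map_smul, eq_neg_of_add_eq_zero_left h1, smul_neg, smul_smul, neg_eq_zero, smul_eq_zero] at h
  exact h.resolve_right F.f_last

theorem exists_self (hl : 3 ≤ l) (A : F.Act x a b γ v z) (hI : IsIdeal N)
    (hx : SpansCompl N x) :
    ∃ δ : ℂ, bracket x x = δ • f l ∧ δ * (b + l * a) = 0 := by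
  have h0 : ∀ p, bracket p (bracket x x) = 0 := fun p => by rw [leibniz, sub_self]
  obtain ⟨δ, hδ⟩ := F.exists_of_right_annihilator hl (hx.bracket_self_mem hI) h0
  exact ⟨δ, hδ, A.smul_last_eq_zero hl hI (hδ ▸ h0 x)⟩

/-- In the expansion of [x, [y, x]] the term [[x, x], y] is a multiple of [f_l, y] = 0, and the
error c f_l at y contributes c(b + la) f_l = 0. -/
theorem left_bracket_x (hl : 3 ≤ l) (A : F.Act x a b γ v z) (hI : IsIdeal N)
    (hx : SpansCompl N x) {y : R} (hy : y ∈ N) :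
    bracket x (bracket y x) + bracket (bracket y x) x = 0 := by
  obtain ⟨δ, hδ, -⟩ := A.exists_self hl hI hx
  obtain ⟨c, hc⟩ := F.exists_right_add_left hl hI x hy
  have h1 : c * (b + l * a) = 0 := A.smul_last_eq_zero hl hI
    (hc ▸ bracket_symm_right_eq_zero x x y)
  rw [leibniz, hδ, eq_sub_of_add_eq hc]
  simp only [map_sub, map_smul, LinearMap.sub_apply, LinearMap.smul_apply, F.last_bracket hy,
    A.last_x, smul_smul, h1]
  module

theorem left_eq_neg_right (hl : 3 ≤ l) (A : F.Act x a b γ v z) (hI : IsIdeal N)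
    (hx : SpansCompl N x) (hab : ¬(a = 0 ∧ b = 0)) {y : R} (hy : y ∈ N) :
    bracket x y = -bracket y x := by
  rw [eq_neg_iff_add_eq_zero]
  obtain ⟨c, hc⟩ := F.exists_right_add_left hl hI x hy
  -- If b + la ≠ 0, the error c f_l is killed by c(b + la) = 0. Otherwise a and b are both nonzero,
  -- and the symmetrised map S, which vanishes on the image of N under [·, x] and on the tail from
  -- f_1, is killed successively on f_0, e₁ and eₙ.
  by_cases hlam : b + l * a = 0
  swap
  · have h1 : c * (b + l * a) = 0 := A.smul_last_eq_zero hl hI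
      (hc ▸ bracket_symm_right_eq_zero x x y)
    rw [hc, (mul_eq_zero.1 h1).resolve_right hlam, zero_smul]
  have hl0 : (l : ℂ) ≠ 0 := by
    rw [Nat.cast_ne_zero]
    omega
  have ha : a ≠ 0 := by
    rintro rfl
    exact hab ⟨rfl, by simpa using hlam⟩
  have hb : b ≠ 0 := by
    rintro rfl
    rw [zero_add] at hlam
    exact mul_ne_zero hl0 ha hlam
  set S : R →ₗ[ℂ] R := bracket x + bracket.flip x with hS
  have S1 : ∀ y ∈ tail f 1, S y = 0 := fun y hy => A.left_tail_one hl hI hy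
  have SD : ∀ y ∈ N, S (bracket y x) = 0 := fun y hy => A.left_bracket_x hl hI hx hy
  have Sf : S (f 0) = 0 := by
    have := SD _ (F.f_mem 0)
    rw [A.zero_x, map_add, map_smul, S1 z A.z_mem, add_zero] at this
    exact (smul_eq_zero.1 this).resolve_left hb
  have S0 : ∀ y ∈ tail f 0, S y = 0 := by
    intro y hy
    obtain ⟨c, y', hy', rfl⟩ := exists_of_mem_tail hy
    rw [map_add, map_smul, Sf, S1 y' hy', smul_zero, add_zero]
  have Se : S e₁ = 0 := by
    have := SD _ F.one_mem
    rw [A.one_x, map_add, map_smul, S0 v A.v_mem, add_zero] at this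
    exact (smul_eq_zero.1 this).resolve_left ha
  have Sn : S eₙ = 0 := by
    have := SD _ F.n_mem
    rw [A.n_x, map_add, map_sub, map_smul, map_smul, S1 _ (F.one_mem_tail A.v_mem),
      S0 _ (mem_tail (Nat.zero_le l)), sub_zero, smul_zero, add_zero] at this
    exact (smul_eq_zero.1 this).resolve_left (mul_ne_zero two_ne_zero ha)
  obtain ⟨p, q, w, hw, rfl⟩ := F.exists_coord y hy
  change S _ = 0
  rw [map_add, map_add, map_smul, map_smul, Se, Sn, S0 w hw]
  simp

theorem not_nilpotent (A : F.Act x a b γ v z) (hN : IsNilradical N)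
    (hx : SpansCompl N x) : ¬(a = 0 ∧ b = 0) := by
  rintro ⟨rfl, rfl⟩
  have hI := hN.prop.1
  have h1 : lowerCentral (⊤ : Submodule ℂ R) 1 ≤ N :=
    Submodule.map₂_le.2 fun r _ s _ => hx.bracket_mem hI r s
  have h2 : lowerCentral (⊤ : Submodule ℂ R) 2 ≤ tail f 0 := by
    refine Submodule.map₂_le.2 fun r hr s _ => ?_
    obtain ⟨p, q, w, hw, rfl⟩ := F.exists_coord r (h1 hr)
    obtain ⟨d, y, hy, rfl⟩ := hx.2 s
    obtain ⟨p', q', w', hw', rfl⟩ := F.exists_coord y hy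
    have t1 : ∀ y ∈ tail f 0, bracket e₁ y ∈ tail f 0 := fun y hy =>
      tail_anti (Nat.zero_le _) (F.one_mem_tail hy)
    have t2 := A.tail_x_mem hw
    have t3 := t1 _ hw
    have t4 := t1 _ t3
    have t5 := t1 _ hw'
    have t6 := t1 _ t5
    have t7 := A.v_mem
    have t8 := t1 _ t7
    have t9 : f l ∈ tail f 0 := mem_tail (Nat.zero_le l)
    simp only [map_add, map_smul, LinearMap.add_apply, LinearMap.smul_apply, A.one_x, A.n_x,
      F.one_one, F.one_n, F.n_one, F.n_n, F.tail_one hw, F.tail_n hw, F.n_tail hw',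
      F.tail_tail hw hw', zero_smul, mul_zero, smul_zero, zero_add, zero_sub, add_zero]
    repeat' first
      | assumption
      | apply Submodule.smul_mem
      | apply add_mem
      | apply sub_mem
      | apply neg_mem
  -- With a = b = 0, right multiplication by x also moves the flag strictly down, so every further
  -- bracket gains a step.
  have h3 : ∀ k, lowerCentral (⊤ : Submodule ℂ R) (k + 2) ≤ tail f k := by
    intro k
    induction k with
    | zero => exact h2
    | succ k ih =>
      refine Submodule.map₂_le.2 fun r hr s _ => ?_
      obtain ⟨d, y, hy, rfl⟩ := hx.2 s
      obtain ⟨p, q, w, hw, rfl⟩ := F.exists_coord y hy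
      have hr' := ih hr
      have hr0 : r ∈ tail f 0 := tail_anti (Nat.zero_le k) hr'
      simp only [map_add, map_smul, F.tail_one hr0, F.tail_n hr0, F.tail_tail hr0 hw, add_zero]
      have t1 := F.one_mem_tail hr'
      refine add_mem (Submodule.smul_mem _ _ ?_) (add_mem (Submodule.smul_mem _ _ (neg_mem t1))
        (Submodule.smul_mem _ _ (tail_anti (by omega) (F.one_mem_tail t1))))
      refine map_mem_of_mem_tail (bracket.flip x) (fun j hj => ?_) hr'
      have := A.f_x_sub_mem j
      simp only [mul_zero, add_zero, zero_smul, sub_zero] at this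
      exact tail_anti (by omega) this
  -- R is now a nilpotent ideal of itself, so maximality puts x in N.
  refine hx.1 (hN.le_of_ge ⟨fun _ _ _ => ⟨Submodule.mem_top, Submodule.mem_top⟩, l + 3, ?_⟩ le_top
    (Submodule.mem_top (x := x)))
  rw [eq_bot_iff, ← F.tail_eq_bot (Nat.lt_succ_self l)]
  exact h3 (l + 1)

end Act

/-! ### Changes of basis of `g²` -/

/-- The change is unitriangular: each new vector differs from the old one by deeper terms, recovered
by induction from the end of the flag. -/
theorem tail_le_tail_change (F : Frame l N e₁ eₙ f) {w : R} (hw : w ∈ tail f 1) (k : ℕ) :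
    tail f k ≤ tail (fun k => f k + (bracket e₁ ^ k) w) k := by
  suffices H : ∀ d k, l + 1 ≤ k + d → tail f k ≤ tail (fun k => f k + (bracket e₁ ^ k) w) k from
    H (l + 1) k (by omega)
  intro d
  induction d with
  | zero =>
    intro k hk
    rw [F.tail_eq_bot (by omega)]
    exact bot_le
  | succ d ih =>
    intro k hk y hy
    obtain ⟨c, y', hy', rfl⟩ := exists_of_mem_tail hy
    have h1 := (ih (k + 1) (by omega)).trans (tail_anti k.le_succ)
    refine add_mem (Submodule.smul_mem _ _ ?_) (h1 hy')
    have h2 := F.one_pow_mem_tail k hw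
    rw [add_comm 1 k] at h2
    exact (Submodule.add_mem_iff_left _ (h1 h2)).1 (mem_tail le_rfl)

/-- Change of basis of `g²` by `e₁ ↦ e₁ + u`, `eₙ ↦ eₙ - [e₁, u] + s f_l`, `f₀ ↦ f₀ + w`. -/
theorem change (F : Frame l N e₁ eₙ f) {u w : R} (hu : u ∈ tail f 0) (s : ℂ)
    (hw : w ∈ tail f 1) :
    Frame l N (e₁ + u) (eₙ - bracket e₁ u + s • f l) fun k => f k + (bracket e₁ ^ k) w := by
  set g : ℕ → R := fun k => f k + (bracket e₁ ^ k) w with hg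
  have g_sub : ∀ k, g k - f k ∈ tail f (k + 1) := fun k => by
    rw [hg, add_sub_cancel_left, add_comm k]
    exact F.one_pow_mem_tail k hw
  have g_mem : ∀ k, g k ∈ tail f k := fun k => by
    rw [← sub_add_cancel (g k) (f k)]
    exact add_mem (tail_anti (by omega) (g_sub k)) (mem_tail le_rfl)
  have g_mem0 : ∀ k, g k ∈ tail f 0 := fun k => tail_anti (Nat.zero_le k) (g_mem k)
  have g_succ : ∀ k, bracket e₁ (g k) = g (k + 1) := fun k => by
    simp only [hg]
    rw [map_add, F.one_f, pow_succ', Module.End.mul_apply]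
  have g_zero : ∀ k, l < k → g k = 0 := fun k hk => by
    have := g_mem k
    rwa [F.tail_eq_bot hk, Submodule.mem_bot] at this
  have hu' := F.one_mem_tail hu
  have hu0 : bracket e₁ u ∈ tail f 0 := tail_anti (Nat.zero_le _) hu'
  have hf0 : ∀ k, f k ∈ tail f 0 := fun k => mem_tail (Nat.zero_le k)
  have hn : ∀ y ∈ tail f 0, bracket (eₙ - bracket e₁ u + s • f l) y =
      -bracket e₁ (bracket e₁ y) := fun y hy => by
    simp [F.n_tail hy, F.tail_tail hu0 hy, F.tail_tail (hf0 l) hy]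
  have hn' : ∀ y ∈ tail f 0, bracket y (eₙ - bracket e₁ u + s • f l) =
      bracket e₁ (bracket e₁ y) := fun y hy => by
    simp [F.tail_n hy, F.tail_tail hy hu0, F.tail_tail hy (hf0 l)]
  have h1 : ∀ y ∈ tail f 0, bracket (e₁ + u) y = bracket e₁ y := fun y hy => by
    simp [F.tail_tail hu hy]
  have h1' : ∀ y ∈ tail f 0, bracket y (e₁ + u) = -bracket e₁ y := fun y hy => by
    simp [F.tail_tail hy hu, F.tail_one hy]
  constructor
  · exact add_mem F.one_mem (F.tail_le_N _ hu)
  · exact add_mem (sub_mem F.n_mem (F.tail_le_N _ hu')) (N.smul_mem _ (F.f_mem l))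
  · exact fun k => F.tail_le_N _ (g_mem k)
  · intro y hy
    obtain ⟨p, q, v, hv, rfl⟩ := F.exists_coord y hy
    refine ⟨p, q, v - p • u + q • bracket e₁ u - (q * s) • f l, F.tail_le_tail_change hw 0 ?_, ?_⟩
    · exact sub_mem (add_mem (sub_mem hv (Submodule.smul_mem _ _ hu)) (Submodule.smul_mem _ _ hu0))
        (Submodule.smul_mem _ _ (hf0 l))
    · module
  · have := g_sub l
    rw [F.tail_eq_bot (by omega), Submodule.mem_bot, sub_eq_zero] at this
    rw [this]
    exact F.f_last
  · exact g_zero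
  · rw [map_add, h1 u hu]
    simp [F.one_one, F.tail_one hu]
  · simp [F.one_n, F.one_f, F.f_zero, F.tail_n hu, F.tail_tail hu hu0, F.tail_tail hu (hf0 l)]
  · simp [F.n_one, F.f_one, F.f_zero, F.n_tail hu, F.tail_tail hu0 hu, F.tail_tail (hf0 l) hu,
      F.tail_one hu0]
  · rw [map_add, map_sub, map_smul, hn _ hu0, hn _ (hf0 l)]
    simp [F.one_f, F.f_zero, F.tail_n hu0, F.f_n, F.n_n]
  · exact fun k => by rw [h1 _ (g_mem0 k), g_succ]
  · exact fun k => by rw [h1' _ (g_mem0 k), g_succ]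
  · exact fun k => by rw [hn' _ (g_mem0 k), g_succ, g_succ]
  · exact fun k => by rw [hn _ (g_mem0 k), g_succ, g_succ]
  · exact fun j k => F.tail_tail (g_mem0 j) (g_mem0 k)

end Frame

end

/-! ### Normal forms and tables -/

section

/-- The family `e₁, f 0, …, f l, eₙ`, indexed from `1` to `l + 3`. -/
def family {R : Type*} [AddCommGroup R] (l : ℕ) (e₁ eₙ : R) (f : ℕ → R) (i : ℕ) : R :=
  if i = 0 then 0 else if i = 1 then e₁ else if i = l + 3 then eₙ else f (i - 2)

section Family

variable {R : Type*} [AddCommGroup R] {l : ℕ} {e₁ eₙ : R} {f : ℕ → R}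

theorem family_one : family l e₁ eₙ f 1 = e₁ := by simp [family]

theorem family_last : family l e₁ eₙ f (l + 3) = eₙ := by simp [family]

theorem family_f {k : ℕ} (hk : k ≤ l) : family l e₁ eₙ f (k + 2) = f k := by
  have : k ≠ l + 1 := by omega
  simp [family, this]

theorem index_cases {i : ℕ} (hi : i ∈ Finset.Icc 1 (l + 3)) :
    i = 1 ∨ i = l + 3 ∨ ∃ k ≤ l, i = k + 2 := by
  rw [Finset.mem_Icc] at hi
  by_cases h1 : i = 1
  · exact .inl h1
  · by_cases h2 : i = l + 3
    · exact .inr (.inl h2)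
    · exact .inr (.inr ⟨i - 2, by omega, by omega⟩)

end Family

variable {R : Type*} [AddCommGroup R] [Module ℂ R] [LeibnizAlgebra R]

namespace Frame

variable {l : ℕ} {N : Submodule ℂ R} {e₁ eₙ : R} {f : ℕ → R}

theorem exists_one_bracket_eq (F : Frame l N e₁ eₙ f) {v : R} (hv : v ∈ tail f 1) :
    ∃ y ∈ tail f 0, bracket e₁ y = v := by
  have : tail f 1 ≤ (tail f 0).map (bracket e₁) := tail_le fun j hj => by
    obtain ⟨k, rfl⟩ := Nat.exists_eq_add_of_le' hj
    exact ⟨f k, mem_tail (Nat.zero_le k), F.one_f k⟩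
  exact this hv

namespace Act

variable {F : Frame l N e₁ eₙ f} {x : R} {a b γ : ℂ} {v z : R}

theorem smul (A : F.Act x a b γ v z) (s : ℂ) :
    F.Act (s • x) (s * a) (s * b) (s * γ) (s • v) (s • z) where
  v_mem := Submodule.smul_mem _ _ A.v_mem
  z_mem := Submodule.smul_mem _ _ A.z_mem
  one_x := by rw [map_smul, A.one_x]; module
  n_x := by rw [map_smul, A.n_x, map_smul]; module
  zero_x := by rw [map_smul, A.zero_x]; module

theorem add_tail (A : F.Act x a b γ v z) {y : R} (hy : y ∈ tail f 0) :
    F.Act (x + y) a b γ (v + bracket e₁ y) z where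
  v_mem := add_mem A.v_mem (tail_anti (Nat.zero_le _) (F.one_mem_tail hy))
  z_mem := A.z_mem
  one_x := by rw [map_add, A.one_x]; module
  n_x := by rw [map_add, A.n_x, map_add, F.n_tail hy]; module
  zero_x := by rw [map_add, A.zero_x, F.tail_tail (mem_tail le_rfl) hy, add_zero]

theorem add_one (A : F.Act x a b γ v z) (c : ℂ) :
    F.Act (x + c • e₁) a b γ v (z - c • f 1) where
  v_mem := A.v_mem
  z_mem := sub_mem A.z_mem (Submodule.smul_mem _ _ (mem_tail le_rfl))
  one_x := by rw [map_add, A.one_x, map_smul, F.one_one]; module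
  n_x := by rw [map_add, A.n_x, map_smul, F.n_one]; module
  zero_x := by rw [map_add, A.zero_x, map_smul, F.f_one]; module

/-- The factor b + la - 2a is the difference of the diagonal entries at f_l and eₙ; γ can be removed
when it is nonzero. -/
theorem change (A : F.Act x a b γ v z) {u w : R} (hu : u ∈ tail f 0) (s : ℂ)
    (hw : w ∈ tail f 1) :
    (F.change hu s hw).Act x a b (γ + s * (b + l * a - 2 * a)) (v + (bracket u x - a • u))
      (z + (bracket w x - b • w)) where
  v_mem := F.tail_le_tail_change hw 0 <|
    add_mem A.v_mem (sub_mem (A.tail_x_mem hu) (Submodule.smul_mem _ _ hu))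
  z_mem := F.tail_le_tail_change hw 1 <|
    add_mem A.z_mem (sub_mem (A.tail_x_mem hw) (Submodule.smul_mem _ _ hw))
  one_x := by rw [map_add, LinearMap.add_apply, A.one_x]; module
  n_x := by
    have h := F.one_pow_mem_tail l hw
    rw [F.tail_eq_bot (by omega), Submodule.mem_bot] at h
    have h1 : ∀ y ∈ tail f 0, bracket u y = 0 := fun y hy => F.tail_tail hu hy
    simp only [map_add, map_sub, map_smul, LinearMap.add_apply, LinearMap.sub_apply,
      LinearMap.smul_apply, A.n_x, A.one_tail_x hu, A.last_x, h1 _ A.v_mem,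
      h1 _ (A.tail_x_mem hu), h1 _ hu, h]
    module
  zero_x := by
    simp only [pow_zero, Module.End.one_apply, map_add, LinearMap.add_apply, A.zero_x]
    module

end Act

/-- Normal form of an extension whose generator acts trivially on `N / ⟨f 0, …, f l⟩`. -/
theorem exists_normal_zero (F : Frame l N e₁ eₙ f) {x : R} {b γ : ℂ} {v z : R}
    (A : F.Act x 0 b γ v z) (hx : SpansCompl N x) (hb : b ≠ 0) :
    ∃ (e₁ eₙ : R) (f : ℕ → R) (F : Frame l N e₁ eₙ f) (x : R) (z : R),
      F.Act x 0 1 0 0 z ∧ SpansCompl N x ∧ z ∈ tail f 2 := by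
  have A1 := A.smul b⁻¹
  rw [mul_zero, inv_mul_cancel₀ hb] at A1
  obtain ⟨c, z', hz', hz⟩ := exists_of_mem_tail A1.z_mem
  -- As [f_0, e₁] = -f_1, adding c e₁ to x cancels the f_1 coefficient of z.
  have A2 := A1.add_one c
  rw [hz, add_sub_cancel_left] at A2
  set y := b⁻¹ • x + c • e₁
  -- With a = 0 and b = 1 the diagonal on the flag is constantly 1, so [u, y] = -v is solvable; the
  -- factor multiplying s in the change of γ is also 1.
  obtain ⟨u, hu, hu'⟩ := exists_preimage_of_triangular (k := 0) F.f_zero (bracket.flip y)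
    (fun _ => 1) (fun _ _ => one_ne_zero)
    (fun j _ => by simpa using A2.f_x_sub_mem j) _ (neg_mem A2.v_mem)
  have A3 := A2.change hu (-(b⁻¹ * γ)) (zero_mem _)
  rw [LinearMap.flip_apply] at hu'
  refine ⟨_, _, _, F.change hu (-(b⁻¹ * γ)) (zero_mem _), y, z', ?_,
    hx.smul_add_mem (inv_ne_zero hb) (N.smul_mem _ F.one_mem),
    F.tail_le_tail_change (zero_mem _) 2 hz'⟩
  rw [hu'] at A3
  simpa using A3

/-- Normal form of an extension whose generator acts nontrivially on `N / ⟨f 0, …, f l⟩`. -/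
theorem exists_normal_one (F : Frame l N e₁ eₙ f) {x : R} {a b γ : ℂ} {v z : R}
    (A : F.Act x a b γ v z) (hx : SpansCompl N x) (ha : a ≠ 0) :
    ∃ (e₁ eₙ : R) (f : ℕ → R) (F : Frame l N e₁ eₙ f) (x : R) (b γ a₂ : ℂ),
      F.Act x 1 b γ (a₂ • f 0) 0 ∧ SpansCompl N x ∧ (b ≠ 1 → a₂ = 0) ∧
      (b + l - 2 ≠ 0 → γ = 0) := by
  have A1 := A.smul a⁻¹
  rw [inv_mul_cancel₀ ha] at A1
  have hx1 : SpansCompl N (a⁻¹ • x) := by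
    simpa using hx.smul_add_mem (inv_ne_zero ha) N.zero_mem
  generalize a⁻¹ • x = x, a⁻¹ * b = b, a⁻¹ * γ = γ, a⁻¹ • v = v, a⁻¹ • z = z at A1 hx1
  -- With a = 1, right multiplication by x minus b has diagonal entry j ≥ 1 at f_j, so a suitable w
  -- cancels z and each f_k becomes an eigenvector.
  obtain ⟨w, hw, hw'⟩ := exists_preimage_of_triangular (k := 1) F.f_zero
    (bracket.flip x - b • LinearMap.id) (fun j => (j : ℂ))
    (fun j hj => by rw [Nat.cast_ne_zero]; omega)
    (fun j _ => by
      have := A1.f_x_sub_mem j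
      rw [mul_one, add_smul, ← sub_sub] at this
      exact this) _ (neg_mem A1.z_mem)
  have A2 := A1.change (zero_mem _) 0 hw
  change bracket w x - b • w = -z at hw'
  rw [hw', add_neg_cancel] at A2
  revert A2
  generalize F.change (zero_mem _) 0 hw = G
  revert G
  generalize (fun k => f k + (bracket e₁ ^ k) w) = g
  generalize e₁ + 0 = e₁, eₙ - bracket e₁ 0 + (0 : ℂ) • f l = eₙ, v + _ = v, γ + _ = γ
  intro G A2
  -- The part of v beyond f_0 has the form [e₁, y], so translating x by -y removes it.
  obtain ⟨a₂, v', hv', rfl⟩ := exists_of_mem_tail A2.v_mem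
  obtain ⟨y, hy, rfl⟩ := G.exists_one_bracket_eq hv'
  have A3 := A2.add_tail (neg_mem hy)
  rw [map_neg, add_neg_cancel_right] at A3
  have hx2 : SpansCompl N (x + -y) := by
    simpa using hx1.smul_add_mem one_ne_zero (neg_mem (G.tail_le_N _ hy))
  generalize x + -y = x at A3 hx2
  -- At the resonances b = 1 and b + l - 2 = 0 division by zero returns 0, so the same formulas
  -- leave a₂ or γ unchanged.
  have hu : -(a₂ / (b - 1)) • g 0 ∈ tail g 0 := Submodule.smul_mem _ _ (mem_tail le_rfl)
  have A4 := A3.change hu (-(γ / (b + l - 2))) (zero_mem _)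
  refine ⟨_, _, _, G.change hu (-(γ / (b + l - 2))) (zero_mem _), x, b, γ + -(γ / (b + l - 2)) * (b + l - 2),
    a₂ + -(a₂ / (b - 1)) * (b - 1), ?_, hx2, fun h => ?_, fun h => ?_⟩
  · convert A4 using 1
    · ring
    · simp only [map_smul, LinearMap.smul_apply, A3.zero_x, map_zero, add_zero]
      module
    · simp
  · field_simp [sub_ne_zero.2 h]
    ring
  · field_simp
    ring

theorem g2Table (hl : 3 ≤ l) (F : Frame l N e₁ eₙ f) :
    G2Table (l + 3) (family l e₁ eₙ f) := by
  intro i hi j hj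
  rcases index_cases hi with rfl | rfl | ⟨k, hk, rfl⟩ <;>
  rcases index_cases hj with rfl | rfl | ⟨m, hm, rfl⟩ <;>
  simp only [family_one, family_last, family_f, true_and, *]
  · simp [F.one_one]
  · rw [F.one_n]
    simp
  · rw [F.one_f]
    split_ifs <;> first | omega | skip
    · rw [show m + 2 + 1 = m + 1 + 2 by omega, family_f]
      omega
    · exact F.f_zero _ (by omega)
  · rw [F.n_one]
    split_ifs <;> first | omega | rfl
  · rw [F.n_n]
    split_ifs <;> first | omega | rfl
  · rw [F.n_f]
    split_ifs <;> first | omega | skip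
    · rw [family_f]
      omega
    · rw [F.f_zero _ (by omega), neg_zero]
  · rw [F.f_one]
    split_ifs <;> first | omega | skip
    · rw [show k + 2 + 1 = k + 1 + 2 by omega, family_f]
      omega
    · rw [F.f_zero _ (by omega), neg_zero]
  · rw [F.f_n]
    split_ifs <;> first | omega | skip
    · rw [family_f]
      omega
    · exact F.f_zero _ (by omega)
  · rw [F.f_f]
    split_ifs <;> first | omega | rfl

theorem extensionTable (hl : 3 ≤ l) (F : Frame l N e₁ eₙ f) {x q : R} {d : ℕ → R}
    (hleft : ∀ y ∈ N, bracket x y = -bracket y x) (h1 : bracket e₁ x = d 1)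
    (hn : bracket eₙ x = d (l + 3)) (hf : ∀ k ≤ l, bracket (f k) x = d (k + 2))
    (hq : bracket x x = q) : ExtensionTable (l + 3) (family l e₁ eₙ f) x d q := by
  refine ⟨F.g2Table hl, fun i hi => ?_, hq⟩
  rcases index_cases hi with rfl | rfl | ⟨k, hk, rfl⟩
  · rw [family_one, hleft _ F.one_mem, h1]
    exact ⟨rfl, rfl⟩
  · rw [family_last, hleft _ F.n_mem, hn]
    exact ⟨rfl, rfl⟩
  · rw [family_f hk, hleft _ (F.f_mem k), hf k hk]
    exact ⟨rfl, rfl⟩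

theorem linearIndependent_f (F : Frame l N e₁ eₙ f) :
    LinearIndependent ℂ fun k : Fin (l + 1) => f k := by
  rw [Fintype.linearIndependent_iff]
  intro g hg i
  induction i using WellFoundedLT.induction with
  | ind i ih =>
    rw [← Finset.add_sum_erase _ _ (Finset.mem_univ i)] at hg
    refine F.coeff_eq_zero (Nat.le_of_lt_succ i.2) (Submodule.sum_mem _ fun j hj => ?_) hg
    rcases lt_or_gt_of_ne (Finset.ne_of_mem_erase hj) with h | h
    · rw [ih j h, zero_smul]
      exact zero_mem _
    · exact Submodule.smul_mem _ _ (mem_tail h)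

theorem exists_basis (hl : 3 ≤ l) (F : Frame l N e₁ eₙ f) {x : R} (hx : SpansCompl N x) :
    ∃ B : Module.Basis (Fin (l + 3) ⊕ Unit) ℂ R,
      oneIndexed (fun k => B (Sum.inl k)) = family l e₁ eₙ f ∧ B (Sum.inr ()) = x := by
  set g : Fin (l + 3) ⊕ Unit → R :=
    Sum.elim (fun k => family l e₁ eₙ f (k + 1)) fun _ => x with hg
  have g_mem : ∀ k, g (Sum.inl k) ∈ N := by
    intro k
    simp only [hg, Sum.elim_inl]
    rcases index_cases (l := l) (i := k + 1) (Finset.mem_Icc.2 ⟨by omega, k.2⟩) with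
      h | h | ⟨m, hm, h⟩
    · rw [h, family_one]
      exact F.one_mem
    · rw [h, family_last]
      exact F.n_mem
    · rw [h, family_f hm]
      exact F.f_mem m
  have li : LinearIndependent ℂ g := by
    rw [Fintype.linearIndependent_iff]
    intro c hc
    rw [Fintype.sum_sum_type] at hc
    have hcx : c (Sum.inr ()) = 0 := by
      by_contra h
      simp only [Finset.univ_unique, Finset.sum_singleton] at hc
      have h1 : c (Sum.inr ()) • x ∈ N := by
        have h2 : ∑ k, c (Sum.inl k) • g (Sum.inl k) ∈ N :=
          Submodule.sum_mem _ fun k _ => N.smul_mem _ (g_mem k)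
        exact (N.add_mem_iff_right h2).1 (by simpa only using hc ▸ N.zero_mem)
      exact hx.1 ((N.smul_mem_iff h).1 h1)
    have hf : ∀ k : Fin (l + 1), family l e₁ eₙ f (k + 1 + 1) = f k := fun k =>
      family_f (Nat.le_of_lt_succ k.2)
    have hlast : family l e₁ eₙ f (l + 1 + 1 + 1) = eₙ := family_last
    simp only [Finset.univ_unique, Finset.sum_singleton, PUnit.default_eq_unit, hcx, zero_smul,
      add_zero, Fin.sum_univ_succ (n := l + 2), Fin.sum_univ_castSucc (n := l + 1), hg,
      Sum.elim_inl, Fin.val_succ, Fin.val_castSucc, Fin.val_last, Fin.val_zero, zero_add,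
      family_one, hf, hlast] at hc
    obtain ⟨h1, hn, hs⟩ := F.linearIndependent_aux hl
      (Submodule.sum_mem _ fun (k : Fin (l + 1)) _ => Submodule.smul_mem _ _
        (mem_tail (Nat.zero_le k)))
      ((by rw [← hc]; abel : _ • e₁ + _ • eₙ + ∑ k : Fin (l + 1), _ • f k = 0))
    have h0 := Fintype.linearIndependent_iff.1 F.linearIndependent_f _ hs
    rintro (k | ⟨⟩)
    · refine Fin.cases h1 (fun k => ?_) k
      refine Fin.lastCases hn (fun k => ?_) k
      exact h0 k
    · exact hcx
  have sp : ⊤ ≤ Submodule.span ℂ (Set.range g) := by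
    have hfam : ∀ i ∈ Finset.Icc 1 (l + 3), family l e₁ eₙ f i ∈ Submodule.span ℂ (Set.range g) := by
      intro i hi
      rw [Finset.mem_Icc] at hi
      refine Submodule.subset_span ⟨Sum.inl ⟨i - 1, by omega⟩, ?_⟩
      simp only [hg, Sum.elim_inl]
      rw [Nat.sub_add_cancel hi.1]
    have h1 := hfam 1 (Finset.mem_Icc.2 (by omega))
    have hn := hfam (l + 3) (Finset.mem_Icc.2 (by omega))
    rw [family_one] at h1
    rw [family_last] at hn
    have ht : tail f 0 ≤ Submodule.span ℂ (Set.range g) := tail_le fun j _ => by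
      by_cases hj : j ≤ l
      · rw [← family_f (e₁ := e₁) (eₙ := eₙ) (f := f) hj]
        exact hfam (j + 2) (Finset.mem_Icc.2 (by omega))
      · rw [F.f_zero j (by omega)]
        exact zero_mem _
    intro r _
    obtain ⟨c, y, hy, rfl⟩ := hx.2 r
    obtain ⟨p, q, v, hv, rfl⟩ := F.exists_coord y hy
    have hx' : x ∈ Submodule.span ℂ (Set.range g) := Submodule.subset_span ⟨Sum.inr (), rfl⟩
    exact add_mem (Submodule.smul_mem _ _ hx') (add_mem (add_mem (Submodule.smul_mem _ _ h1)
      (Submodule.smul_mem _ _ hn)) (ht hv))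
  refine ⟨Module.Basis.mk li sp, ?_, ?_⟩
  · funext i
    simp only [Module.Basis.coe_mk, oneIndexed, hg, Sum.elim_inl]
    split_ifs with hi
    · rw [Nat.sub_add_cancel hi.1]
    · by_cases h0 : i = 0
      · simp [family, h0]
      · rw [family, if_neg h0, if_neg (by omega), if_neg (by omega), F.f_zero _ (by omega)]
  · simp [hg]

end Frame

/-- The five families of tables. -/
def HasTable (n : ℕ) (e : ℕ → R) (x : R) : Prop :=
  (∃ b : ℕ → ℂ, R1Table n b e x) ∨ (∃ a₂ : ℂ, R2Table n a₂ e x) ∨ (∃ γ : ℂ, R3Table n γ e x) ∨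
    (∃ δ : ℂ, R4Table n δ e x) ∨
    (∃ b₂ : ℂ, b₂ ≠ 1 ∧ b₂ ≠ 5 - (n : ℂ) ∧ b₂ ≠ 3 - (n : ℂ) ∧ R5Table n b₂ e x)

namespace Frame.Act

variable {l : ℕ} {N : Submodule ℂ R} {e₁ eₙ : R} {f : ℕ → R} {F : Frame l N e₁ eₙ f} {x : R}

theorem r1Table {z : R} (hl : 3 ≤ l) (A : F.Act x 0 1 0 0 z) (hI : IsIdeal N)
    (hx : SpansCompl N x) (hz : z ∈ tail f 2) :
    ∃ b : ℕ → ℂ, R1Table (l + 3) b (family l e₁ eₙ f) x := by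
  obtain ⟨δ, hδ, hδ'⟩ := A.exists_self hl hI hx
  obtain ⟨c, rfl⟩ := exists_sum_of_mem_tail F.f_zero hz
  refine ⟨fun j => c (j - 2), F.extensionTable hl
    (fun y hy => A.left_eq_neg_right hl hI hx (by simp) hy) ?_ ?_ (fun k hk => ?_) ?_⟩
  · simp [A.one_x]
  · simp [A.n_x]
  · rw [A.f_x, if_pos (by omega), family_f hk, map_sum, mul_zero, add_zero, one_smul]
    congr 1
    symm
    -- The coefficient c_s of f_s in z contributes c_s f_{s+k} to [f_k, x], and f_{s+k} is e_t for t
    -- = s + k + 2; terms with s + k > l vanish.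
    refine Finset.sum_of_injOn (fun t => t - (k + 2)) ?_ ?_ ?_ ?_
    · intro s hs t ht hst
      simp only [Finset.coe_Icc, Set.mem_Icc] at hs ht hst
      omega
    · intro t ht
      simp only [Finset.coe_Icc, Set.mem_Icc] at ht ⊢
      omega
    · intro t ht ht'
      rw [Finset.mem_Icc] at ht
      rw [map_smul, F.one_pow_f, F.f_zero, smul_zero]
      by_contra h
      refine ht' ⟨t + (k + 2), ?_, Nat.add_sub_cancel _ _⟩
      simp only [Finset.coe_Icc, Set.mem_Icc]
      omega
    · intro t ht
      rw [Finset.mem_Icc] at ht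
      obtain ⟨s, rfl⟩ := Nat.exists_eq_add_of_le' (show k + 2 ≤ t by omega)
      simp only [Nat.add_sub_cancel, map_smul, F.one_pow_f]
      rw [← add_assoc, family_f (by omega)]
  · have : δ = 0 := by simpa using hδ'
    rw [hδ, this, zero_smul]

/-- The critical values 1, 2 - l = 5 - n and -l = 3 - n are pairwise distinct, so at most one of a₂,
γ, δ survives. -/
theorem hasTable_of_one {b γ a₂ : ℂ} (hl : 3 ≤ l) (A : F.Act x 1 b γ (a₂ • f 0) 0)
    (hI : IsIdeal N) (hx : SpansCompl N x) (ha₂ : b ≠ 1 → a₂ = 0) (hγ : b + l - 2 ≠ 0 → γ = 0) :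
    HasTable (l + 3) (family l e₁ eₙ f) x := by
  obtain ⟨δ, hδ, hδ'⟩ := A.exists_self hl hI hx
  have hleft := fun y hy => A.left_eq_neg_right hl hI hx (fun h => one_ne_zero h.1) (y := y) hy
  have hfx : ∀ k, bracket (f k) x = (b + k) • f k := fun k => by simp [A.f_x]
  have h1x := A.one_x
  have hnx := A.n_x
  rw [map_smul, F.one_f] at hnx
  have f0 : family l e₁ eₙ f 2 = f 0 := family_f (Nat.zero_le l)
  have f1 : family l e₁ eₙ f 3 = f 1 := family_f (by omega)
  have fl : family l e₁ eₙ f (l + 2) = f l := family_f le_rfl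
  have hk1 : ∀ k, k + 2 ≠ 1 := fun k => by omega
  have hkl : ∀ k, k ≤ l → k + 2 ≠ l + 3 := fun k hk => by omega
  have hl3 : l + 3 ≠ 1 := by omega
  have hδ0 : b ≠ -l → δ = 0 := fun h => (mul_eq_zero.1 hδ').resolve_right fun h' =>
    h (by linear_combination h')
  have hl1 : (l : ℂ) ≠ 1 := by exact_mod_cast (by omega : l ≠ 1)
  have hlneg : (1 : ℂ) ≠ -l := fun h => by
    have : ((l + 1 : ℕ) : ℂ) = 0 := by
      push_cast
      linear_combination h
    exact Nat.succ_ne_zero l (Nat.cast_eq_zero.1 this)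
  by_cases h1 : b = 1
  · subst h1
    rw [hγ fun h => hl1 (by linear_combination h)] at hnx
    refine .inr (.inl ⟨a₂, F.extensionTable hl hleft ?_ ?_ (fun k hk => ?_) ?_⟩)
    · simp only [if_true, family_one, f0, h1x, one_smul]
    · simp only [if_neg hl3, if_true, family_last, f1, hnx]
      module
    · simp only [if_neg (hk1 k), if_neg (hkl k hk), family_f hk, hfx]
      push_cast
      module
    · rw [hδ, hδ0 hlneg, zero_smul]
  rw [ha₂ h1, zero_smul, add_zero] at h1x
  rw [ha₂ h1, zero_smul, sub_zero] at hnx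
  by_cases h2 : b = 2 - l
  · have hb : b ≠ -l := fun h => two_ne_zero (α := ℂ) (by linear_combination h - h2)
    refine .inr (.inr (.inl ⟨γ, F.extensionTable hl hleft ?_ ?_ (fun k hk => ?_) ?_⟩))
    · simp only [if_true, family_one, h1x, one_smul]
    · simp only [if_neg hl3, if_true, family_last, hnx, fl,
        show l + 3 - 1 = l + 2 from rfl]
      module
    · simp only [if_neg (hk1 k), if_neg (hkl k hk), family_f hk, hfx, h2]
      push_cast
      module
    · rw [hδ, hδ0 hb, zero_smul]
  rw [hγ fun h => h2 (by linear_combination h), zero_smul, add_zero] at hnx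
  by_cases h3 : b = -l
  · refine .inr (.inr (.inr (.inl ⟨δ, F.extensionTable hl hleft ?_ ?_ (fun k hk => ?_) ?_⟩)))
    · simp only [if_true, family_one, h1x, one_smul]
    · simp only [if_neg hl3, if_true, family_last, hnx, mul_one]
    · simp only [if_neg (hk1 k), if_neg (hkl k hk), family_f hk, hfx, h3]
      push_cast
      module
    · rw [hδ, show l + 3 - 1 = l + 2 from rfl, fl]
  · refine .inr (.inr (.inr (.inr ⟨b, h1, fun h => h2 ?_, fun h => h3 ?_,
      F.extensionTable hl hleft ?_ ?_ (fun k hk => ?_) ?_⟩)))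
    · rw [h]
      push_cast
      ring
    · rw [h]
      push_cast
      ring
    · simp only [if_true, family_one, h1x, one_smul]
    · simp only [if_neg hl3, if_true, family_last, hnx, mul_one]
    · simp only [if_neg (hk1 k), if_neg (hkl k hk), family_f hk, hfx]
      push_cast
      module
    · rw [hδ, hδ0 h3, zero_smul]

end Frame.Act

/-! ### From the hypotheses to a frame and a generator -/

theorem IsG2.exists_frame {l : ℕ} {N : Submodule ℂ R} (hg : IsG2 (l + 3) N) :
    ∃ (e₁ eₙ : R) (f : ℕ → R), Frame l N e₁ eₙ f := by
  obtain ⟨v, hv⟩ := hg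
  set e : ℕ → R := oneIndexed fun k => (v k : R) with he
  -- The cut-off is essential: without it f_{l+1} would be eₙ rather than 0.
  set f : ℕ → R := fun k => if k ≤ l then e (k + 2) else 0 with hf
  have e_succ : ∀ k : Fin (l + 3), e (k + 1) = v k := by
    intro k
    simp [he, oneIndexed, Nat.succ_le_iff.2 k.2]
  have e_mem : ∀ i, e i ∈ N := by
    intro i
    simp only [he, oneIndexed]
    split_ifs
    · exact Subtype.coe_prop _
    · exact N.zero_mem
  have br : ∀ i j, 1 ≤ i → i ≤ l + 3 → 1 ≤ j → j ≤ l + 3 → _ := fun i j h1 h2 h3 h4 =>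
    hv i (Finset.mem_Icc.2 ⟨h1, h2⟩) j (Finset.mem_Icc.2 ⟨h3, h4⟩)
  refine ⟨e 1, e (l + 3), f, e_mem _, e_mem _, fun k => ?_, fun y hy => ?_, ?_, ?_, ?_, ?_, ?_, ?_,
    fun k => ?_, fun k => ?_, fun k => ?_, fun k => ?_, fun j k => ?_⟩
  · simp only [hf]
    split_ifs
    · exact e_mem _
    · exact N.zero_mem
  · have hS : ∀ k : Fin (l + 3), (v k : R) ∈
        (Submodule.span ℂ {e 1} ⊔ Submodule.span ℂ {e (l + 3)}) ⊔ tail f 0 := by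
      intro k
      rw [← e_succ]
      rcases index_cases (l := l) (i := k + 1) (Finset.mem_Icc.2 ⟨by omega, k.2⟩) with
        h | h | ⟨m, hm, h⟩
      · rw [h]
        exact Submodule.mem_sup_left (Submodule.mem_sup_left (Submodule.mem_span_singleton_self _))
      · rw [h]
        exact Submodule.mem_sup_left (Submodule.mem_sup_right (Submodule.mem_span_singleton_self _))
      · rw [h]
        have : f m ∈ tail f 0 := mem_tail (Nat.zero_le m)
        simp only [hf, if_pos hm] at this
        exact Submodule.mem_sup_right this
    have hy' : y ∈ (Submodule.span ℂ {e 1} ⊔ Submodule.span ℂ {e (l + 3)}) ⊔ tail f 0 := by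
      have := congrArg (Subtype.val) (v.sum_repr ⟨y, hy⟩)
      change _ = y at this
      rw [← this, Submodule.coe_sum]
      exact Submodule.sum_mem _ fun k _ => Submodule.smul_mem _ _ (hS k)
    obtain ⟨_, h1, w, hw, rfl⟩ := Submodule.mem_sup.1 hy'
    obtain ⟨_, h2, _, h3, rfl⟩ := Submodule.mem_sup.1 h1
    obtain ⟨p, rfl⟩ := Submodule.mem_span_singleton.1 h2
    obtain ⟨q, rfl⟩ := Submodule.mem_span_singleton.1 h3
    exact ⟨p, q, w, hw, rfl⟩
  · simp only [hf, le_refl, if_true]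
    have := e_succ ⟨l + 1, by omega⟩
    simp only at this
    rw [this]
    exact fun h => v.ne_zero _ (Subtype.ext h)
  · intro k hk
    simp [hf, Nat.not_le.2 hk]
  · rw [br 1 1 (by omega) (by omega) (by omega) (by omega)]
    split_ifs <;> first | omega | rfl
  · rw [br 1 (l + 3) (by omega) (by omega) (by omega) (by omega)]
    split_ifs <;> first | omega | rfl
  · rw [br (l + 3) 1 (by omega) (by omega) (by omega) (by omega)]
    split_ifs <;> first | omega | rfl
  · rw [br (l + 3) (l + 3) (by omega) (by omega) (by omega) (by omega)]
    split_ifs <;> first | omega | rfl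
  all_goals simp only [hf]
  · by_cases hk : k ≤ l
    · rw [if_pos hk, br 1 (k + 2) (by omega) (by omega) (by omega) (by omega)]
      split_ifs <;> first | omega | rfl
    · rw [if_neg hk, if_neg (by omega), map_zero]
  · by_cases hk : k ≤ l
    · rw [if_pos hk, br (k + 2) 1 (by omega) (by omega) (by omega) (by omega)]
      split_ifs <;> first | omega | rfl | exact neg_zero.symm
    · rw [if_neg hk, if_neg (by omega), map_zero, LinearMap.zero_apply, neg_zero]
  · by_cases hk : k ≤ l
    · rw [if_pos hk, br (k + 2) (l + 3) (by omega) (by omega) (by omega) (by omega)]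
      split_ifs <;> first | omega | rfl
    · rw [if_neg hk, if_neg (by omega), map_zero, LinearMap.zero_apply]
  · by_cases hk : k ≤ l
    · rw [if_pos hk, br (l + 3) (k + 2) (by omega) (by omega) (by omega) (by omega)]
      split_ifs <;> first | omega | rfl | exact neg_zero.symm
    · rw [if_neg hk, if_neg (by omega), map_zero, neg_zero]
  · by_cases hj : j ≤ l
    · by_cases hk : k ≤ l
      · rw [if_pos hk, if_pos hj, br (j + 2) (k + 2) (by omega) (by omega) (by omega) (by omega)]
        split_ifs <;> first | omega | rfl
      · rw [if_neg hk, map_zero]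
    · rw [if_neg hj, map_zero, LinearMap.zero_apply]

theorem exists_spansCompl {R : Type*} [AddCommGroup R] [Module ℂ R] {N Q : Submodule ℂ R} (hNQ : IsCompl N Q)
    (hQ : Module.finrank ℂ Q = 1) : ∃ x, SpansCompl N x := by
  obtain ⟨⟨x, hx⟩, h0, h⟩ := finrank_eq_one_iff'.1 hQ
  refine ⟨x, fun hxN => h0 ?_, fun r => ?_⟩
  · exact Subtype.ext (Submodule.disjoint_def.1 hNQ.disjoint x hxN hx)
  · obtain ⟨y, hy, w, hw, rfl⟩ := Submodule.mem_sup.1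
      (hNQ.sup_eq_top ▸ Submodule.mem_top : r ∈ N ⊔ Q)
    obtain ⟨c, hc⟩ := h ⟨w, hw⟩
    exact ⟨c, y, hy, by rw [add_comm y w]; exact congrArg (· + y) (congrArg Subtype.val hc).symm⟩

end

end LeibnizAlgebra

theorem mainTheorem7 (n : ℕ) (hn : 6 ≤ n)
    (R : Type*) [AddCommGroup R] [Module ℂ R] [LeibnizAlgebra R]
    (hsol : LeibnizAlgebra.Solvable R)
    (N Q : Submodule ℂ R)
    (hN : LeibnizAlgebra.IsNilradical N) (hg : LeibnizAlgebra.IsG2 n N)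
    (hNQ : IsCompl N Q) (hQ : Module.finrank ℂ Q = 1) :
    ∃ (B : Module.Basis (Fin n ⊕ Unit) ℂ R) (e : ℕ → R) (x : R),
      e = LeibnizAlgebra.oneIndexed (fun k => B (Sum.inl k)) ∧ x = B (Sum.inr ()) ∧
      ((∃ b : ℕ → ℂ, LeibnizAlgebra.R1Table n b e x) ∨
       (∃ a₂ : ℂ, LeibnizAlgebra.R2Table n a₂ e x) ∨
       (∃ γ : ℂ, LeibnizAlgebra.R3Table n γ e x) ∨
       (∃ δ : ℂ, LeibnizAlgebra.R4Table n δ e x) ∨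
       (∃ b₂ : ℂ, b₂ ≠ 1 ∧ b₂ ≠ 5 - (n : ℂ) ∧ b₂ ≠ 3 - (n : ℂ) ∧
          LeibnizAlgebra.R5Table n b₂ e x)) := by
  obtain ⟨l, rfl⟩ := Nat.exists_eq_add_of_le' (show 3 ≤ n by omega)
  have hl : 3 ≤ l := by omega
  have hI := hN.prop.1
  obtain ⟨e₁, eₙ, f, F⟩ := hg.exists_frame
  obtain ⟨x, hx⟩ := LeibnizAlgebra.exists_spansCompl hNQ hQ
  obtain ⟨a, b, γ, v, z, A⟩ := F.exists_act hl fun y hy => (hI y hy x).1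
  have hab := A.not_nilpotent hN hx
  by_cases ha : a = 0
  · subst ha
    obtain ⟨e₁, eₙ, f, F, x, z, A, hx, hz⟩ := F.exists_normal_zero A hx fun hb => hab ⟨rfl, hb⟩
    obtain ⟨B, hB, hBx⟩ := F.exists_basis hl hx
    refine ⟨B, _, _, rfl, rfl, .inl ?_⟩
    rw [hB, hBx]
    exact A.r1Table hl hI hx hz
  · obtain ⟨e₁, eₙ, f, F, x, b, γ, a₂, A, hx, ha₂, hγ⟩ := F.exists_normal_one A hx ha
    obtain ⟨B, hB, hBx⟩ := F.exists_basis hl hx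
    refine ⟨B, _, _, rfl, rfl, ?_⟩
    rw [hB, hBx]
    exact A.hasTable_of_one hl hI hx ha₂ hγ
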